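/- Let $R$ be a commutative Noetherian ring, let $I$ be an ideal of $R$, and let $M$ be an arbitrary $R$-module (not necessarily finitely generated). Then the following conditions are equivalent: (i) $\operatorname{Tor}^R_n(R/I, M) = 0$ for all integers $n \ge 0$; (ii) $\operatorname{Ext}^n_R(R/I, M) = 0$ for all integers $n \ge 0$. -/

import Mathlib

open CategoryTheory CategoryTheory.Limits

universe u

/-! Let `s` be a finite generating set of `I`, which exists because `R` is Noetherian. Both
conditions are equivalent to exactness of the Koszul complex `K` of `s` with coefficients in `M`, a
bounded complex of finite sums of copies of `M`. If all `Tor` or all `Ext` of `M` vanish, so do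
those of the terms of `K`. Since `I` kills the homology of `K`, exactness spreads degree by degree:
downwards from the top for `Tor`, as cycles `Z` with `R/I ⊗ Z = 0` satisfy `Z = I Z`; upwards from
the bottom for `Ext`, as `Hom(R/I, N) = 0` leaves no nonzero element of `N` killed by `I`.
Conversely, let `K` be exact. The functors kill the differentials, whose coefficients lie in `I`;
induction on the degree of the functor and the sequences `Z n ⟶ X n ⟶ Z (n + 1)` then make an
extreme term of `K` vanish, and `M` is a retract of it. -/

/-! ### Koszul complexes -/

section Koszul

variable {R : Type u} [CommRing R]

/-- `N` is obtained from `M` by taking finite direct sums, up to isomorphism. -/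
inductive IsFiniteDirectSum (M : ModuleCat.{u} R) : ModuleCat.{u} R → Prop
  | of_equiv (N : ModuleCat.{u} R) (e : N ≃ₗ[R] M) : IsFiniteDirectSum M N
  | of_subsingleton (N : ModuleCat.{u} R) (h : Subsingleton N) : IsFiniteDirectSum M N
  | prod (N N' : ModuleCat.{u} R) (h : IsFiniteDirectSum M N) (h' : IsFiniteDirectSum M N') :
      IsFiniteDirectSum M (ModuleCat.of R (N × N'))

/-- `N` is a retract of `N'`. -/
def IsRetractOf (N N' : ModuleCat.{u} R) : Prop :=
  ∃ (i : N →ₗ[R] N') (p : N' →ₗ[R] N), p ∘ₗ i = LinearMap.id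

/-- A bounded complex which shares with the Koszul complex of `s` with coefficients in `M`
the properties that relate its exactness to the vanishing of `Tor` and `Ext`. -/
structure KoszulLike (s : Set R) (M : ModuleCat.{u} R) where
  /-- The terms of the complex. -/
  X : ℤ → ModuleCat.{u} R
  /-- The differentials of the complex. -/
  d : ∀ n, X n →ₗ[R] X (n + 1)
  d_d : ∀ n z, d (n + 1) (d n z) = 0
  nullhomotopic : ∀ r ∈ s, ∃ h : ∀ n, X (n + 1) →ₗ[R] X n,
    ∀ n z, d n (h n z) + h (n + 1) (d (n + 1) z) = r • z
  d_mem : ∀ n, d n ∈ Ideal.span s • (⊤ : Submodule R (X n →ₗ[R] X (n + 1)))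
  isFiniteDirectSum : ∀ n, IsFiniteDirectSum M (X n)
  subsingleton_of_pos : ∀ n, 0 < n → Subsingleton (X n)
  isRetractOf_zero : IsRetractOf M (X 0)
  /-- The lowest degree of the complex. -/
  bot : ℤ
  subsingleton_of_lt_bot : ∀ n, n < bot → Subsingleton (X n)
  isRetractOf_bot : IsRetractOf M (X bot)

namespace KoszulLike

/-- The module `M` in degree zero. -/
def single (M : ModuleCat.{u} R) : KoszulLike (∅ : Set R) M where
  X n := ModuleCat.of R (if n = 0 then ⊤ else ⊥ : Submodule R M)
  d n := 0
  d_d n z := rfl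
  nullhomotopic r hr := hr.elim
  d_mem n := zero_mem _
  isFiniteDirectSum n := by
    by_cases h : n = 0
    · refine .of_equiv _ ?_
      rw [if_pos h]
      exact Submodule.topEquiv
    · refine .of_subsingleton _ ?_
      rw [if_neg h]
      exact inferInstanceAs (Subsingleton (⊥ : Submodule R M))
  subsingleton_of_pos n hn := by
    rw [if_neg hn.ne']
    exact inferInstanceAs (Subsingleton (⊥ : Submodule R M))
  isRetractOf_zero := ⟨Submodule.topEquiv.symm.toLinearMap, Submodule.topEquiv.toLinearMap, rfl⟩
  bot := 0
  subsingleton_of_lt_bot n hn := by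
    rw [if_neg hn.ne]
    exact inferInstanceAs (Subsingleton (⊥ : Submodule R M))
  isRetractOf_bot := ⟨Submodule.topEquiv.symm.toLinearMap, Submodule.topEquiv.toLinearMap, rfl⟩

theorem comp_mem_smul_top {A B C D : Type*} [AddCommGroup A] [AddCommGroup B] [AddCommGroup C]
    [AddCommGroup D] [Module R A] [Module R B] [Module R C] [Module R D] {I : Ideal R}
    {f : B →ₗ[R] C} (hf : f ∈ I • (⊤ : Submodule R (B →ₗ[R] C))) (g : A →ₗ[R] B) (h : C →ₗ[R] D) :
    h ∘ₗ f ∘ₗ g ∈ I • (⊤ : Submodule R (A →ₗ[R] D)) := by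
  induction hf using Submodule.smul_induction_on' with
  | smul r hr f hf =>
    rw [LinearMap.smul_comp, LinearMap.comp_smul]
    exact Submodule.smul_mem_smul hr trivial
  | add f hf f' hf' h1 h2 =>
    rw [LinearMap.add_comp, LinearMap.comp_add]
    exact add_mem h1 h2

/-- The shifted mapping cone of multiplication by `x`. -/
def cone {s : Set R} {M : ModuleCat.{u} R} (K : KoszulLike s M) (x : R) :
    KoszulLike (insert x s) M where
  X n := ModuleCat.of R (K.X (n + 1) × K.X n)
  d n := LinearMap.prod (K.d (n + 1) ∘ₗ LinearMap.fst R _ _)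
    (x • LinearMap.fst R _ _ - K.d n ∘ₗ LinearMap.snd R _ _)
  d_d n z := by
    ext <;> simp [K.d_d]
  nullhomotopic r hr := by
    -- For the new element the homotopy is `(a, b) ↦ (b, 0)`. For an old one the sign in `(h, -h)`
    -- cancels the cross terms `x • h a`.
    rcases hr with rfl | hr
    · refine ⟨fun n => LinearMap.inl R _ _ ∘ₗ LinearMap.snd R _ _, fun n z => ?_⟩
      ext <;> simp
    · obtain ⟨h, hh⟩ := K.nullhomotopic r hr
      refine ⟨fun n => LinearMap.prodMap (h (n + 1)) (- h n), fun n z => ?_⟩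
      ext
      · simpa using hh (n + 1) z.1
      · simp [← hh n z.2]
        abel
  d_mem n := by
    have hs : Ideal.span s ≤ Ideal.span (insert x s) := Ideal.span_mono (Set.subset_insert x s)
    have h1 := comp_mem_smul_top (Submodule.smul_mono_left hs (K.d_mem (n + 1)))
      (LinearMap.fst R (K.X (n + 1)) (K.X n)) (LinearMap.inl R _ (K.X (n + 1)))
    have h2 := comp_mem_smul_top (Submodule.smul_mono_left hs (K.d_mem n))
      (LinearMap.snd R (K.X (n + 1)) (K.X n)) (LinearMap.inr R (K.X (n + 1 + 1)) _)
    have h3 := Submodule.smul_mem_smul (Ideal.subset_span (Set.mem_insert x s))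
      (Submodule.mem_top (R := R) (x := LinearMap.inr R (K.X (n + 1 + 1)) (K.X (n + 1)) ∘ₗ
        LinearMap.fst R (K.X (n + 1)) (K.X n)))
    convert sub_mem (add_mem h1 h3) h2 using 1
    ext <;> simp
  isFiniteDirectSum n := .prod _ _ (K.isFiniteDirectSum _) (K.isFiniteDirectSum _)
  subsingleton_of_pos n hn :=
    have := K.subsingleton_of_pos n hn
    have := K.subsingleton_of_pos (n + 1) (by lia)
    inferInstanceAs (Subsingleton (K.X (n + 1) × K.X n))
  isRetractOf_zero := by
    obtain ⟨i, p, h⟩ := K.isRetractOf_zero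
    exact ⟨LinearMap.inr R _ _ ∘ₗ i, p ∘ₗ LinearMap.snd R _ _, h⟩
  bot := K.bot - 1
  subsingleton_of_lt_bot n hn :=
    have := K.subsingleton_of_lt_bot n (by lia)
    have := K.subsingleton_of_lt_bot (n + 1) (by lia)
    inferInstanceAs (Subsingleton (K.X (n + 1) × K.X n))
  isRetractOf_bot := by
    rw [sub_add_cancel]
    obtain ⟨i, p, h⟩ := K.isRetractOf_bot
    exact ⟨LinearMap.inl R _ _ ∘ₗ i, p ∘ₗ LinearMap.fst R _ _, h⟩

theorem nonempty (s : Finset R) (M : ModuleCat.{u} R) : Nonempty (KoszulLike (s : Set R) M) := by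
  classical
  induction s using Finset.induction_on with
  | empty => exact ⟨by rw [Finset.coe_empty]; exact single M⟩
  | insert x s _ ih =>
    obtain ⟨K⟩ := ih
    exact ⟨by rw [Finset.coe_insert]; exact K.cone x⟩

variable {s : Set R} {M : ModuleCat.{u} R} (K : KoszulLike s M)

/-- The complex is exact in every degree. -/
def Exact : Prop := ∀ n, LinearMap.ker (K.d (n + 1)) ≤ LinearMap.range (K.d n)

theorem smul_mem_range {r : R} (hr : r ∈ Ideal.span s) {n : ℤ} {z : K.X (n + 1)}
    (hz : K.d (n + 1) z = 0) : r • z ∈ LinearMap.range (K.d n) := by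
  suffices Ideal.span s ≤ (LinearMap.range (K.d n)).comap (LinearMap.toSpanSingleton R _ z) from
    this hr
  refine Ideal.span_le.mpr fun r hr => ?_
  obtain ⟨h, hh⟩ := K.nullhomotopic r hr
  exact ⟨h n z, by simpa [hz] using hh n z⟩

end KoszulLike

end Koszul

/-! ### Exactness of the complex and vanishing of derived functors -/

section Families

variable {R : Type u} [CommRing R]

/-- The formal properties of the functors `Ext^j(R/I, -)`. -/
structure IsCohomologicalFor {A : Type*} [Category* A] [Abelian A] (I : Ideal R)
    (T : ℕ → ModuleCat.{u} R ⥤ A) [∀ j, (T j).Additive] : Prop where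
  map_smul : ∀ j, ∀ r ∈ I, ∀ {N N' : ModuleCat.{u} R} (f : N ⟶ N'), (T j).map (r • f) = 0
  mono : ∀ {S : ShortComplex (ModuleCat.{u} R)}, S.ShortExact → Mono ((T 0).map S.f)
  exact₂ : ∀ {S : ShortComplex (ModuleCat.{u} R)}, S.ShortExact → ∀ j, (S.map (T j)).Exact
  exists_δ : ∀ {S : ShortComplex (ModuleCat.{u} R)}, S.ShortExact → ∀ j,
    ∃ (δ : (T j).obj S.X₃ ⟶ (T (j + 1)).obj S.X₁) (w : (T j).map S.g ≫ δ = 0)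
      (w' : δ ≫ (T (j + 1)).map S.f = 0),
      (ShortComplex.mk _ _ w).Exact ∧ (ShortComplex.mk _ _ w').Exact
  eq_zero : ∀ {N : ModuleCat.{u} R}, IsZero ((T 0).obj N) → ∀ z : N, (∀ r ∈ I, r • z = 0) → z = 0

/-- The formal properties of the functors `Tor_j(R/I, -)`. -/
structure IsHomologicalFor {A : Type*} [Category* A] [Abelian A] (I : Ideal R)
    (T : ℕ → ModuleCat.{u} R ⥤ A) [∀ j, (T j).Additive] : Prop where
  map_smul : ∀ j, ∀ r ∈ I, ∀ {N N' : ModuleCat.{u} R} (f : N ⟶ N'), (T j).map (r • f) = 0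
  epi : ∀ {S : ShortComplex (ModuleCat.{u} R)}, S.ShortExact → Epi ((T 0).map S.g)
  exact₂ : ∀ {S : ShortComplex (ModuleCat.{u} R)}, S.ShortExact → ∀ j, (S.map (T j)).Exact
  exists_δ : ∀ {S : ShortComplex (ModuleCat.{u} R)}, S.ShortExact → ∀ j,
    ∃ (δ : (T (j + 1)).obj S.X₃ ⟶ (T j).obj S.X₁) (w : (T (j + 1)).map S.g ≫ δ = 0)
      (w' : δ ≫ (T j).map S.f = 0),
      (ShortComplex.mk _ _ w).Exact ∧ (ShortComplex.mk _ _ w').Exact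
  le_smul : ∀ {N : ModuleCat.{u} R}, IsZero ((T 0).obj N) → (⊤ : Submodule R N) ≤ I • ⊤

theorem isZero_of_exact {A : Type*} [Category* A] [Abelian A] {S : ShortComplex A} (hS : S.Exact)
    (h₁ : IsZero S.X₁) (h₃ : IsZero S.X₃) : IsZero S.X₂ :=
  hS.isZero_of_both_zeros (h₁.eq_of_src _ _) (h₃.eq_of_tgt _ _)

theorem shortExact_of_linearMap {A B C : ModuleCat.{u} R} (f : A →ₗ[R] B) (g : B →ₗ[R] C)
    (hf : Function.Injective f) (hfg : Function.Exact f g) (hg : Function.Surjective g) :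
    (ShortComplex.mk (ModuleCat.ofHom f) (ModuleCat.ofHom g)
      (by rw [← ModuleCat.ofHom_comp, hfg.linearMap_comp_eq_zero]; rfl)).ShortExact where
  exact := (ShortComplex.ShortExact.moduleCat_exact_iff_function_exact _).mpr hfg
  mono_f := (ModuleCat.mono_iff_injective _).mpr hf
  epi_g := (ModuleCat.epi_iff_surjective _).mpr hg

theorem isZero_map_of_isRetractOf {A : Type*} [Category* A] [Abelian A]
    (F : ModuleCat.{u} R ⥤ A) {N N' : ModuleCat.{u} R} (h : IsRetractOf N N')
    (h' : IsZero (F.obj N')) : IsZero (F.obj N) := by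
  obtain ⟨i, p, hip⟩ := h
  refine (IsZero.iff_id_eq_zero _).mpr ?_
  rw [← F.map_id, ← ModuleCat.ofHom_id, ← hip, ModuleCat.ofHom_comp, F.map_comp]
  rw [h'.eq_of_tgt (F.map (ModuleCat.ofHom i)) 0, zero_comp]

section Additive

variable {A : Type*} [Category* A] [Abelian A] (F : ModuleCat.{u} R ⥤ A) [F.Additive]

theorem isZero_map_of_subsingleton (N : ModuleCat.{u} R) [Subsingleton N] : IsZero (F.obj N) :=
  F.map_isZero (ModuleCat.isZero_of_subsingleton N)

theorem isZero_map_of_isFiniteDirectSum {M N : ModuleCat.{u} R} (h : IsFiniteDirectSum M N)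
    (hM : IsZero (F.obj M)) : IsZero (F.obj N) := by
  induction h with
  | of_equiv N e => exact hM.of_iso (F.mapIso e.toModuleIso)
  | of_subsingleton N h => exact isZero_map_of_subsingleton F N
  | prod N N' _ _ h h' =>
    refine (IsZero.iff_id_eq_zero _).mpr ?_
    have key : 𝟙 (ModuleCat.of R (N × N')) =
        ModuleCat.ofHom (LinearMap.fst R N N') ≫ ModuleCat.ofHom (LinearMap.inl R N N') +
        ModuleCat.ofHom (LinearMap.snd R N N') ≫ ModuleCat.ofHom (LinearMap.inr R N N') := by
      ext x <;> simp
    rw [← F.map_id, key, F.map_add, F.map_comp, F.map_comp,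
      h.eq_of_src (F.map (ModuleCat.ofHom (LinearMap.inl R N N'))) 0,
      h'.eq_of_src (F.map (ModuleCat.ofHom (LinearMap.inr R N N'))) 0]
    simp

theorem map_ofHom_eq_zero_of_mem_smul_top {I : Ideal R}
    (hF : ∀ r ∈ I, ∀ {N N' : ModuleCat.{u} R} (f : N ⟶ N'), F.map (r • f) = 0)
    {N N' : ModuleCat.{u} R} {f : N →ₗ[R] N'} (hf : f ∈ I • (⊤ : Submodule R (N →ₗ[R] N'))) :
    F.map (ModuleCat.ofHom f) = 0 := by
  induction hf using Submodule.smul_induction_on' with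
  | smul r hr f hf => exact hF r hr (ModuleCat.ofHom f)
  | add f hf f' hf' h1 h2 =>
    have : ModuleCat.ofHom (f + f') = ModuleCat.ofHom f + ModuleCat.ofHom f' := rfl
    rw [this, F.map_add, h1, h2, add_zero]

end Additive

namespace KoszulLike

variable {s : Set R} {M : ModuleCat.{u} R} (K : KoszulLike s M)

/-- The cycles of the complex. -/
abbrev Z (n : ℤ) : ModuleCat.{u} R := ModuleCat.of R (LinearMap.ker (K.d n))

/-- The short complex `Z n ⟶ X n ⟶ Z (n + 1)`. -/
def cyclesShortComplex (n : ℤ) : ShortComplex (ModuleCat.{u} R) where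
  X₁ := K.Z n
  X₂ := K.X n
  X₃ := K.Z (n + 1)
  f := ModuleCat.ofHom (Submodule.subtype _)
  g := ModuleCat.ofHom ((K.d n).codRestrict _ (K.d_d n))
  zero := by
    ext z
    exact z.2

theorem cyclesShortComplex_shortExact {n : ℤ}
    (h : LinearMap.ker (K.d (n + 1)) ≤ LinearMap.range (K.d n)) :
    (K.cyclesShortComplex n).ShortExact := by
  refine shortExact_of_linearMap (A := K.Z n) (C := K.Z (n + 1))
    (Submodule.subtype _) ((K.d n).codRestrict _ (K.d_d n))
    (Submodule.subtype_injective _) (fun x => ?_) fun y => ?_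
  · exact ⟨fun hx => ⟨⟨x, congrArg Subtype.val hx⟩, rfl⟩, by rintro ⟨y, rfl⟩; exact Subtype.ext y.2⟩
  · obtain ⟨x, hx⟩ := h y.2
    exact ⟨x, Subtype.ext hx⟩

theorem map_g_comp_map_f {A : Type*} [Category* A] [Abelian A] {F : ModuleCat.{u} R ⥤ A} [F.Additive]
    (hF : ∀ r ∈ Ideal.span s, ∀ {N N' : ModuleCat.{u} R} (f : N ⟶ N'), F.map (r • f) = 0) (n : ℤ) :
    F.map (K.cyclesShortComplex n).g ≫ F.map (K.cyclesShortComplex (n + 1)).f = 0 :=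
  (F.map_comp _ _).symm.trans (map_ofHom_eq_zero_of_mem_smul_top F hF (K.d_mem n))

theorem subsingleton_Z_bot (hK : K.Exact) : Subsingleton (K.Z K.bot) := by
  have key : ∀ n, n + 1 = K.bot → Subsingleton (K.Z (n + 1)) := by
    intro n hn
    have := K.subsingleton_of_lt_bot n (by lia)
    refine subsingleton_of_forall_eq 0 fun z => ?_
    obtain ⟨x, hx⟩ := hK n z.2
    rw [Subsingleton.elim x 0, map_zero] at hx
    exact Subtype.ext hx.symm
  have := key (K.bot - 1) (by lia)
  rwa [sub_add_cancel] at this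

end KoszulLike

namespace IsCohomologicalFor

variable {A : Type*} [Category* A] [Abelian A] {T : ℕ → ModuleCat.{u} R ⥤ A}
  [∀ j, (T j).Additive]

section

variable {I : Ideal R} (hT : IsCohomologicalFor I T) {S : ShortComplex (ModuleCat.{u} R)}
  (hS : S.ShortExact)
include hT hS

theorem isZero_X₃ {j : ℕ} (h₂ : IsZero ((T j).obj S.X₂)) (h₁ : IsZero ((T (j + 1)).obj S.X₁)) :
    IsZero ((T j).obj S.X₃) := by
  obtain ⟨δ, w, w', h, h'⟩ := hT.exists_δ hS j
  exact isZero_of_exact h h₂ h₁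

theorem isZero_X₁_zero (h₂ : IsZero ((T 0).obj S.X₂)) : IsZero ((T 0).obj S.X₁) :=
  have := hT.mono hS
  h₂.of_mono ((T 0).map S.f)

theorem isZero_X₁_succ {j : ℕ} (h₃ : IsZero ((T j).obj S.X₃))
    (h₂ : IsZero ((T (j + 1)).obj S.X₂)) : IsZero ((T (j + 1)).obj S.X₁) := by
  obtain ⟨δ, w, w', h, h'⟩ := hT.exists_δ hS j
  exact isZero_of_exact h' h₃ h₂

theorem mono_map_f {q : ℕ} (h₃ : ∀ j, j < q → IsZero ((T j).obj S.X₃)) :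
    Mono ((T q).map S.f) := by
  obtain _ | j := q
  · exact hT.mono hS
  · obtain ⟨δ, w, w', h, h'⟩ := hT.exists_δ hS j
    exact h'.mono_g ((h₃ j (by lia)).eq_of_src _ _)

end

variable {s : Set R} {M : ModuleCat.{u} R} (K : KoszulLike s M)
  (hT : IsCohomologicalFor (Ideal.span s) T)
include hT

/-- Dimension shifting from `Z n` to the boundaries and then to `X (n + 1)` modulo boundaries shows
that this quotient has no nonzero element killed by `I`, whereas classes of cycles are killed by
`I`. -/
theorem exact_of_isZero (h : ∀ j, IsZero ((T j).obj M)) : K.Exact := by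
  have hX : ∀ n j, IsZero ((T j).obj (K.X n)) := fun n j =>
    isZero_map_of_isFiniteDirectSum (T j) (K.isFiniteDirectSum n) (h j)
  have step : ∀ n, (∀ j, IsZero ((T j).obj (K.Z n))) →
      LinearMap.ker (K.d (n + 1)) ≤ LinearMap.range (K.d n) := by
    intro n hn
    have hr : ∀ j, IsZero ((T j).obj (ModuleCat.of R (LinearMap.range (K.d n)))) := fun j =>
      isZero_X₃ hT (shortExact_of_linearMap (A := K.Z n)
        (C := ModuleCat.of R (LinearMap.range (K.d n))) (Submodule.subtype _) (K.d n).rangeRestrict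
        (Submodule.subtype_injective _) (fun x => by simp [Subtype.ext_iff])
        (K.d n).surjective_rangeRestrict) (hX n j) (hn (j + 1))
    have hq : IsZero ((T 0).obj (ModuleCat.of R (K.X (n + 1) ⧸ LinearMap.range (K.d n)))) :=
      isZero_X₃ hT (shortExact_of_linearMap (A := ModuleCat.of R (LinearMap.range (K.d n)))
        (C := ModuleCat.of R (K.X (n + 1) ⧸ LinearMap.range (K.d n)))
        (Submodule.subtype _) (Submodule.mkQ _)
        (Submodule.subtype_injective _) (LinearMap.exact_subtype_mkQ _)
        (Submodule.mkQ_surjective _)) (hX (n + 1) 0) (hr 1)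
    intro z hz
    rw [← Submodule.Quotient.mk_eq_zero]
    refine hT.eq_zero hq _ fun r hr => ?_
    exact (Submodule.Quotient.mk_eq_zero _).mpr (K.smul_mem_range hr hz)
  have low : ∀ n, n < K.bot → ∀ j, IsZero ((T j).obj (K.Z n)) := fun n hn j =>
    have := K.subsingleton_of_lt_bot n hn
    isZero_map_of_subsingleton (T j) (K.Z n)
  have succ : ∀ n, (∀ j, IsZero ((T j).obj (K.Z n))) →
      ∀ j, IsZero ((T j).obj (K.Z (n + 1))) := fun n hn j =>
    isZero_X₃ hT (K.cyclesShortComplex_shortExact (step n hn)) (hX n j) (hn (j + 1))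
  have all : ∀ n, ∀ j, IsZero ((T j).obj (K.Z n)) := by
    intro n
    rcases lt_or_ge n K.bot with hn | hn
    · exact low n hn
    -- The base is one degree below `K.bot`, where the term itself is zero.
    · refine Int.leInduction (m := K.bot - 1) (motive := fun n _ => ∀ j, IsZero ((T j).obj (K.Z n)))
        (low _ (by lia)) (fun n _ h => succ n h) n (by lia)
  exact fun n => step n (all n)

/-- Vanishing below degree `q` makes `T q` injective on the inclusions of cycles. As `T q` kills
`d`, it kills `X n ⟶ Z (n + 1)`; in the lowest degree `Z` is zero, so `T q` kills the whole term. -/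
theorem isZero_of_exact (hK : K.Exact) (j : ℕ) : IsZero ((T j).obj M) := by
  induction j using Nat.strong_induction_on with
  | _ q ih =>
  have hX : ∀ n j, j < q → IsZero ((T j).obj (K.X n)) := fun n j hj =>
    isZero_map_of_isFiniteDirectSum (T j) (K.isFiniteDirectSum n) (ih j hj)
  have hS n := K.cyclesShortComplex_shortExact (hK n)
  have hZ : ∀ j, j < q → ∀ n, IsZero ((T j).obj (K.Z n)) := by
    intro j
    induction j with
    | zero => exact fun hj n => hT.isZero_X₁_zero (hS n) (hX n 0 hj)
    | succ j ihj => exact fun hj n => hT.isZero_X₁_succ (hS n) (ihj (by lia) _) (hX n _ hj)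
  have hmono : ∀ n, Mono ((T q).map (K.cyclesShortComplex n).f) := fun n =>
    hT.mono_map_f (hS n) fun j hj => hZ j hj _
  have hg : (T q).map (K.cyclesShortComplex K.bot).g = 0 :=
    @zero_of_comp_mono _ _ _ _ _ _ _ _ (hmono (K.bot + 1)) (K.map_g_comp_map_f (hT.map_smul q) K.bot)
  have := K.subsingleton_Z_bot hK
  have h₁ : IsZero ((T q).obj (K.Z K.bot)) := isZero_map_of_subsingleton (T q) (K.Z K.bot)
  exact isZero_map_of_isRetractOf (T q) K.isRetractOf_bot
    ((hT.exact₂ (hS K.bot) q).isZero_of_both_zeros (h₁.eq_of_src _ _) hg)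

end IsCohomologicalFor

namespace IsHomologicalFor

variable {A : Type*} [Category* A] [Abelian A] {T : ℕ → ModuleCat.{u} R ⥤ A}
  [∀ j, (T j).Additive]

section

variable {I : Ideal R} (hT : IsHomologicalFor I T) {S : ShortComplex (ModuleCat.{u} R)}
  (hS : S.ShortExact)
include hT hS

theorem isZero_X₁ {j : ℕ} (h₃ : IsZero ((T (j + 1)).obj S.X₃)) (h₂ : IsZero ((T j).obj S.X₂)) :
    IsZero ((T j).obj S.X₁) := by
  obtain ⟨δ, w, w', h, h'⟩ := hT.exists_δ hS j
  exact isZero_of_exact h' h₃ h₂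

theorem isZero_X₃_zero (h₂ : IsZero ((T 0).obj S.X₂)) : IsZero ((T 0).obj S.X₃) :=
  have := hT.epi hS
  h₂.of_epi ((T 0).map S.g)

theorem isZero_X₃_succ {j : ℕ} (h₂ : IsZero ((T (j + 1)).obj S.X₂))
    (h₁ : IsZero ((T j).obj S.X₁)) : IsZero ((T (j + 1)).obj S.X₃) := by
  obtain ⟨δ, w, w', h, h'⟩ := hT.exists_δ hS j
  exact isZero_of_exact h h₂ h₁

theorem epi_map_g {q : ℕ} (h₁ : ∀ j, j < q → IsZero ((T j).obj S.X₁)) :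
    Epi ((T q).map S.g) := by
  obtain _ | j := q
  · exact hT.epi hS
  · obtain ⟨δ, w, w', h, h'⟩ := hT.exists_δ hS j
    exact h.epi_f ((h₁ j (by lia)).eq_of_tgt _ _)

end

variable {s : Set R} {M : ModuleCat.{u} R} (K : KoszulLike s M)
  (hT : IsHomologicalFor (Ideal.span s) T)
include hT

theorem exact_of_isZero (h : ∀ j, IsZero ((T j).obj M)) : K.Exact := by
  have hX : ∀ n j, IsZero ((T j).obj (K.X n)) := fun n j =>
    isZero_map_of_isFiniteDirectSum (T j) (K.isFiniteDirectSum n) (h j)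
  have step : ∀ n, (∀ j, IsZero ((T j).obj (K.Z (n + 1)))) →
      LinearMap.ker (K.d (n + 1)) ≤ LinearMap.range (K.d n) := by
    intro n hn
    have hle : LinearMap.ker (K.d (n + 1)) ≤
        Ideal.span s • LinearMap.ker (K.d (n + 1)) := by
      have := Submodule.map_mono (f := Submodule.subtype (LinearMap.ker (K.d (n + 1))))
        (hT.le_smul (hn 0))
      rw [Submodule.map_smul''] at this
      simpa using this
    exact hle.trans (Submodule.smul_le.mpr fun r hr z hz => K.smul_mem_range hr hz)
  have high : ∀ n, 0 < n → ∀ j, IsZero ((T j).obj (K.Z n)) := fun n hn j =>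
    have := K.subsingleton_of_pos n hn
    isZero_map_of_subsingleton (T j) (K.Z n)
  have pred : ∀ n, (∀ j, IsZero ((T j).obj (K.Z (n + 1)))) →
      ∀ j, IsZero ((T j).obj (K.Z n)) := fun n hn j =>
    isZero_X₁ hT (K.cyclesShortComplex_shortExact (step n hn)) (hn (j + 1)) (hX n j)
  have all : ∀ n, ∀ j, IsZero ((T j).obj (K.Z n)) := by
    intro n
    rcases lt_or_ge 0 n with hn | hn
    · exact high n hn
    · refine Int.leInductionDown (m := 1) (motive := fun n _ => ∀ j, IsZero ((T j).obj (K.Z n)))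
        (high _ (by lia)) (fun n _ h => pred (n - 1) (by rwa [sub_add_cancel])) n (by lia)
  exact fun n => step n (all (n + 1))

/-- Dual to the cohomological case: `T q` is surjective on `X n ⟶ Z (n + 1)`, hence kills the
inclusions of cycles, and degree `0` is the top, where `Z 1` is zero. -/
theorem isZero_of_exact (hK : K.Exact) (j : ℕ) : IsZero ((T j).obj M) := by
  induction j using Nat.strong_induction_on with
  | _ q ih =>
  have hX : ∀ n j, j < q → IsZero ((T j).obj (K.X n)) := fun n j hj =>
    isZero_map_of_isFiniteDirectSum (T j) (K.isFiniteDirectSum n) (ih j hj)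
  have hS n := K.cyclesShortComplex_shortExact (hK n)
  have hZ : ∀ j, j < q → ∀ n, IsZero ((T j).obj (K.Z (n + 1))) := by
    intro j
    induction j with
    | zero => exact fun hj n => hT.isZero_X₃_zero (hS n) (hX n 0 hj)
    | succ j ihj =>
      refine fun hj n => hT.isZero_X₃_succ (hS n) (hX n _ hj) ?_
      have := ihj (by lia) (n - 1)
      rwa [sub_add_cancel] at this
  have hepi : ∀ n, Epi ((T q).map (K.cyclesShortComplex n).g) := fun n => by
    refine hT.epi_map_g (hS n) fun j hj => ?_
    have := hZ j hj (n - 1)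
    rwa [sub_add_cancel] at this
  have hf : (T q).map (K.cyclesShortComplex 0).f = 0 :=
    @zero_of_epi_comp _ _ _ _ _ _ _ _ (hepi (-1)) (K.map_g_comp_map_f (hT.map_smul q) (-1))
  have : Subsingleton (K.Z (0 + 1)) :=
    have := K.subsingleton_of_pos (0 + 1) (by lia)
    inferInstanceAs (Subsingleton (LinearMap.ker (K.d (0 + 1))))
  have h₃ : IsZero ((T q).obj (K.Z (0 + 1))) := isZero_map_of_subsingleton (T q) _
  exact isZero_map_of_isRetractOf (T q) K.isRetractOf_zero
    ((hT.exact₂ (hS 0) q).isZero_of_both_zeros hf (h₃.eq_of_tgt _ _))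

end IsHomologicalFor

end Families

theorem smul_id_quotient_eq_zero {R : Type u} [CommRing R] {I : Ideal R} {r : R} (hr : r ∈ I) :
    r • 𝟙 (ModuleCat.of R (R ⧸ I)) = 0 := by
  ext
  simpa [Algebra.smul_def] using Ideal.Quotient.eq_zero_iff_mem.mpr hr

/-! ### The case of `Ext` -/

section Ext

open Abelian

variable {R : Type u} [CommRing R]

theorem isCohomologicalFor_ext (I : Ideal R) :
    IsCohomologicalFor I (fun j => extFunctorObj (ModuleCat.of R (R ⧸ I)) j) where
  map_smul j r hr N N' f := by
    ext (e : Ext _ _ _)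
    change e.comp (Ext.mk₀ (r • f)) (add_zero j) = 0
    -- By bilinearity `r` moves to the identity of `R/I`, where it acts as zero.
    have : e = (Ext.mk₀ (𝟙 _)).comp e (zero_add _) := by simp
    rw [Ext.mk₀_smul, Ext.comp_smul, ← Ext.smul_comp, this, ← Ext.smul_comp, ← Ext.mk₀_smul, smul_id_quotient_eq_zero hr]
    simp
  mono hS :=
    have := hS.mono_f
    Ext.mono_postcomp_mk₀_of_mono _ _
  exact₂ hS j := Ext.covariant_sequence_exact₂' _ hS j
  exists_δ hS j := ⟨_, _, _, Ext.covariant_sequence_exact₃' _ hS j (j + 1) rfl,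
    Ext.covariant_sequence_exact₁' _ hS j (j + 1) rfl⟩
  eq_zero {N} hN z hz := by
    let φ : (R ⧸ I) →ₗ[R] N := I.liftQ (LinearMap.toSpanSingleton R N z) fun r hr => hz r hr
    have : Subsingleton (Ext (ModuleCat.of R (R ⧸ I)) N 0) :=
      AddCommGrpCat.subsingleton_of_isZero hN
    have h := (Ext.mk₀_bijective _ _).1 (Subsingleton.elim (Ext.mk₀ (ModuleCat.ofHom φ)) (Ext.mk₀ 0))
    have := congr($(h) (Submodule.Quotient.mk 1))
    exact (one_smul R z).symm.trans this

end Ext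

/-! ### The case of `Tor`, via a projective resolution -/

section Tor

open MonoidalCategory

variable {R : Type u} [CommRing R]

/-- The functor `N ↦ P ⊗ N` for a complex `P`. -/
noncomputable def tensorComplex (P : ChainComplex (ModuleCat.{u} R) ℕ) :
    ModuleCat.{u} R ⥤ ChainComplex (ModuleCat.{u} R) ℕ where
  obj N := (((tensoringRight (ModuleCat.{u} R)).obj N).mapHomologicalComplex _).obj P
  map f :=
    { f i := P.X i ◁ f
      comm' i j _ := whisker_exchange (P.d i j) f }

instance (P : ChainComplex (ModuleCat.{u} R) ℕ) : (tensorComplex P).Additive where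
  map_add {N N' f g} := by
    ext i : 1
    exact MonoidalPreadditive.whiskerLeft_add f g

/-- The functor `N ↦ H_j(P ⊗ N)` for a complex `P`. -/
noncomputable def homologyTensor (P : ChainComplex (ModuleCat.{u} R) ℕ) (j : ℕ) :
    ModuleCat.{u} R ⥤ ModuleCat.{u} R :=
  tensorComplex P ⋙ HomologicalComplex.homologyFunctor _ _ j

instance (P : ChainComplex (ModuleCat.{u} R) ℕ) (j : ℕ) : (homologyTensor P j).Additive :=
  inferInstanceAs (tensorComplex P ⋙ HomologicalComplex.homologyFunctor _ _ j).Additive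

theorem map_tensorComplex_shortExact (P : ChainComplex (ModuleCat.{u} R) ℕ)
    [∀ n, Projective (P.X n)] {S : ShortComplex (ModuleCat.{u} R)} (hS : S.ShortExact) :
    (S.map (tensorComplex P)).ShortExact := by
  refine HomologicalComplex.shortExact_of_degreewise_shortExact _ fun n => ?_
  have : Module.Flat R (P.X n) := inferInstance
  have hex := (ShortComplex.ShortExact.moduleCat_exact_iff_function_exact _).mp hS.exact
  exact shortExact_of_linearMap (A := P.X n ⊗ S.X₁) (B := P.X n ⊗ S.X₂) (C := P.X n ⊗ S.X₃)
    (S.f.hom.lTensor (P.X n)) (S.g.hom.lTensor (P.X n))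
    (Module.Flat.lTensor_preserves_injective_linearMap _ hS.moduleCat_injective_f)
    (lTensor_exact _ hex hS.moduleCat_surjective_g)
    (LinearMap.lTensor_surjective _ hS.moduleCat_surjective_g)

/-- `H_j(P ⊗ N)` for a projective resolution `P` of `X` computes `Tor_j(X, N)`. -/
noncomputable def homologyTensorIsoTor' {X : ModuleCat.{u} R} (P : ProjectiveResolution X)
    (N : ModuleCat.{u} R) (j : ℕ) :
    ((Tor' (ModuleCat.{u} R) j).obj X).obj N ≅ (homologyTensor P.complex j).obj N :=
  P.isoLeftDerivedObj ((tensoringRight (ModuleCat.{u} R)).obj N) j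

theorem isHomologicalFor_homologyTensor (I : Ideal R)
    (P : ProjectiveResolution (ModuleCat.of R (R ⧸ I))) :
    IsHomologicalFor I (homologyTensor P.complex) where
  map_smul j r hr N N' f := by
    -- Multiplication by `r` on the resolution lifts the zero map of `R/I`, so it is nullhomotopic
    -- and remains so after tensoring.
    have hP : (r • 𝟙 P.complex) ≫ P.π = 0 := by
      have : (r • 𝟙 P.complex) ≫ P.π =
          P.π ≫ (ChainComplex.single₀ (ModuleCat.{u} R)).map (r • 𝟙 _) := by
        ext : 1
        change (r • 𝟙 (P.complex.X 0)) ≫ P.π.f 0 = P.π.f 0 ≫ (r • 𝟙 _)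
        ext x
        exact ((P.π.f 0).hom.map_smul r x)
      rw [this, smul_id_quotient_eq_zero hr, Functor.map_zero, comp_zero]
    have hh := ProjectiveResolution.liftHomotopyZero _ hP
    let a : (tensorComplex P.complex).obj N ⟶ (tensorComplex P.complex).obj N :=
      (((tensoringRight (ModuleCat.{u} R)).obj N).mapHomologicalComplex _).map (r • 𝟙 P.complex)
    have ha : HomologicalComplex.homologyMap a j = 0 := by
      have := (((tensoringRight (ModuleCat.{u} R)).obj N).mapHomotopy hh).homologyMap_eq j
      rwa [Functor.map_zero, HomologicalComplex.homologyMap_zero] at this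
    have key : (tensorComplex P.complex).map (r • f) = a ≫ (tensorComplex P.complex).map f := by
      ext i : 1
      change P.complex.X i ◁ (r • f) = ((r • 𝟙 (P.complex.X i)) ▷ N) ≫ (P.complex.X i ◁ f)
      refine ModuleCat.hom_ext (TensorProduct.ext' fun p n => ?_)
      exact TensorProduct.tmul_smul r p (f.hom n)
    change HomologicalComplex.homologyMap ((tensorComplex P.complex).map (r • f)) j = 0
    rw [key, HomologicalComplex.homologyMap_comp, ha, zero_comp]
  epi {S} hS := by
    have : Epi (((tensorComplex P.complex).map S.g).f 0) :=
      (ModuleCat.epi_iff_surjective _).mpr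
        (LinearMap.lTensor_surjective (P.complex.X 0) hS.moduleCat_surjective_g)
    exact HomologicalComplex.epi_homologyMap_of_epi_of_not_rel
      ((tensorComplex P.complex).map S.g) 0 (by simp)
  exact₂ hS j := (map_tensorComplex_shortExact P.complex hS).homology_exact₂ j
  exists_δ hS j := ⟨_, _, _,
    (map_tensorComplex_shortExact P.complex hS).homology_exact₃ (j + 1) j rfl,
    (map_tensorComplex_shortExact P.complex hS).homology_exact₁ (j + 1) j rfl⟩
  le_smul {N} hN := by
    have h : IsZero (((tensoringRight (ModuleCat.{u} R)).obj N).obj (ModuleCat.of R (R ⧸ I))) :=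
      (hN.of_iso (homologyTensorIsoTor' P N 0)).of_iso
        ((((tensoringRight (ModuleCat.{u} R)).obj N).leftDerivedZeroIsoSelf).app _).symm
    have : Subsingleton (TensorProduct R (R ⧸ I) N) := ModuleCat.subsingleton_of_isZero h
    have := (TensorProduct.quotTensorEquivQuotSMul N I).symm.toEquiv.subsingleton
    exact (Submodule.Quotient.subsingleton_iff.mp this).ge

end Tor

/-- For a commutative Noetherian ring `R`, an ideal `I` and an `R`-module `M`:
`Tor_n^R(R/I, M) = 0` for all `n ≥ 0` iff `Ext^n_R(R/I, M) = 0` for all `n ≥ 0`.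
Here `((Tor' _ n).obj X).obj Y` is the `n`-th left derived functor of `- ⊗ Y` evaluated at `X`. -/
theorem proposition3p2 {R : Type u} [CommRing R] [IsNoetherianRing R] (I : Ideal R)
    (M : Type u) [AddCommGroup M] [Module R M] :
    (∀ n : ℕ, IsZero (((Tor' (ModuleCat.{u} R) n).obj (ModuleCat.of R (R ⧸ I))).obj
      (ModuleCat.of R M))) ↔
    (∀ n : ℕ, Subsingleton (Abelian.Ext.{u} (ModuleCat.of R (R ⧸ I)) (ModuleCat.of R M) n)) := by
  obtain ⟨s, rfl⟩ := IsNoetherian.noetherian I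
  obtain ⟨K⟩ := KoszulLike.nonempty s (ModuleCat.of R M)
  let P := ProjectiveResolution.of (ModuleCat.of R (R ⧸ Ideal.span (s : Set R)))
  have hTor := isHomologicalFor_homologyTensor _ P
  have hExt := isCohomologicalFor_ext (Ideal.span (s : Set R))
  constructor
  · intro h n
    exact AddCommGrpCat.subsingleton_of_isZero (hExt.isZero_of_exact K (hTor.exact_of_isZero K
      fun j => (h j).of_iso (homologyTensorIsoTor' P _ j).symm) n)
  · intro h n
    exact (hTor.isZero_of_exact K (hExt.exact_of_isZero K fun j =>
      have : Subsingleton ((Abelian.extFunctorObj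
          (ModuleCat.of R (R ⧸ Ideal.span (s : Set R))) j).obj (ModuleCat.of R M)) := h j
      AddCommGrpCat.isZero_of_subsingleton _) n).of_iso (homologyTensorIsoTor' P _ n)
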